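/- Let $I\subseteq\mathbb{R}[x_1,\dots,x_n]$ be an ideal and $w\in\mathbb{R}^n$. For $f=\sum_a f_a x^a$ let $\deg_w(f)=\max\{w^Ta : f_a\neq 0\}$, let $\mathrm{In}_w(f)=\sum_{a:\,w^Ta=\deg_w(f)}f_ax^a$ (with $\mathrm{In}_w(0)=0$), and let $\mathrm{In}_w(I)=\langle \mathrm{In}_w(f) : f\in I\rangle$. For an ideal $J$ let $\mathcal V_{\mathbb R}(J)=\{x\in\mathbb{R}^n : f(x)=0\ \forall f\in J\}$ and $\mathcal V_{\mathbb R^*}(J)=\mathcal V_{\mathbb R}(J)\cap(\mathbb{R}\setminus\{0\})^n$. A point $p\in\mathcal V_{\mathbb R}(J)$ is called nonsingular if the local ring $(\mathbb{R}[x_1,\dots,x_n]/J)_p$, the localization of $\mathbb{R}[x_1,\dots,x_n]/J$ at the maximal ideal of $p$, is a regular local ring. For $c>0$ write $c^w\cdot x=(c^{w_1}x_1,\dots,c^{w_n}x_n)$. 1. If $p$ is a nonsingular point of $\mathcal V_{\mathbb R}(\mathrm{In}_w(I))$, then there exist $c_0>0$ and points $x_c\in\mathbb{R}^n$ for $c\in(c_0,\infty)$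 such that $c^w\cdot x_c\in\mathcal V_{\mathbb R}(I)$ for all $c>c_0$ and $x_c\to p$ as $c\to\infty$. 2. Consequently, if some nonsingular point of $\mathcal V_{\mathbb R}(\mathrm{In}_w(I))$ lies in $\mathcal V_{\mathbb R^*}(\mathrm{In}_w(I))$, then $w$ belongs to the logarithmic limit set $\mathrm{LL}(\mathcal V_{\mathbb R^*}(I))$. Here, for $V\subseteq(\mathbb{R}\setminus\{0\})^n$, $\mathrm{LL}(V)$ is the set of all $u\in\mathbb{R}^n$ for which there are sequences $y(k)\in V$ and $t(k)\in(0,1)$ with $t(k)\to0$ and $\log_{1/t(k)}|y(k)|\to u$, where $|\cdot|$ and $\log$ are taken coordinatewise. -/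

import Mathlib

open Filter Topology

noncomputable section

namespace RealTropical

open MvPolynomial

variable {n : ℕ}

/-- The `w`-degree `max {wᵀa : f_a ≠ 0}` of `f`, equal to `⊥` for `f = 0`. -/
def wDegree (w : Fin n → ℝ) (f : MvPolynomial (Fin n) ℝ) : WithBot ℝ :=
  weightedTotalDegree' w f

open Classical in
/-- The initial form `In_w(f)`: the sum of the terms `f_a x^a` of `f` with
`wᵀa = deg_w(f)`. -/
def initialForm (w : Fin n → ℝ) (f : MvPolynomial (Fin n) ℝ) : MvPolynomial (Fin n) ℝ :=
  ∑ a ∈ f.support with ((∑ i, w i * (a i : ℝ) : ℝ) : WithBot ℝ) = wDegree w f,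
    monomial a (coeff a f)

/-- The initial ideal `In_w(I)`, generated by the initial forms of all elements of `I`. -/
def initialIdeal (w : Fin n → ℝ) (I : Ideal (MvPolynomial (Fin n) ℝ)) :
    Ideal (MvPolynomial (Fin n) ℝ) :=
  Ideal.span {g | ∃ f ∈ I, g = initialForm w f}

/-- The real variety `V_ℝ(I)`. -/
def realVariety (I : Ideal (MvPolynomial (Fin n) ℝ)) : Set (Fin n → ℝ) :=
  {x | ∀ f ∈ I, eval x f = 0}

/-- The variety `V_{ℝ*}(I)`: the points of `V_ℝ(I)` all of whose coordinates are nonzero. -/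
def realTorusVariety (I : Ideal (MvPolynomial (Fin n) ℝ)) : Set (Fin n → ℝ) :=
  {x | (∀ i, x i ≠ 0) ∧ ∀ f ∈ I, eval x f = 0}

/-- The maximal ideal of all polynomials vanishing at the point `p`. -/
def pointIdeal (p : Fin n → ℝ) : Ideal (MvPolynomial (Fin n) ℝ) :=
  RingHom.ker (eval p)

instance pointIdeal_isPrime (p : Fin n → ℝ) : (pointIdeal p).IsPrime :=
  RingHom.ker_isPrime _

/-- The local ring `(ℝ[x] / J)_p` at `p` of the scheme defined by `J`, presented as the local ring
`ℝ[x]_p` of affine space at `p` modulo the extension of `J`. -/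
abbrev LocalRingAt (J : Ideal (MvPolynomial (Fin n) ℝ)) (p : Fin n → ℝ) : Type :=
  Localization.AtPrime (pointIdeal p) ⧸
    J.map (algebraMap (MvPolynomial (Fin n) ℝ) (Localization.AtPrime (pointIdeal p)))

/-- `p` is a nonsingular point of `V_ℝ(J)`: the local ring of `ℝ[x] / J` at `p` is regular. -/
def IsNonsingularPoint (J : Ideal (MvPolynomial (Fin n) ℝ)) (p : Fin n → ℝ) : Prop :=
  p ∈ realVariety J ∧ IsRegularLocalRing (LocalRingAt J p)

/-- The torus action `c^w · x = (c^{w_1} x_1, …, c^{w_n} x_n)`, for `c > 0`. -/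
def torusScale (c : ℝ) (w x : Fin n → ℝ) : Fin n → ℝ :=
  fun i => c ^ (w i) * x i

/-- The coordinatewise absolute value `|V|` of a set `V`. -/
def absSet (V : Set (Fin n → ℝ)) : Set (Fin n → ℝ) :=
  (fun x i => |x i|) '' V

/-- The logarithmic limit set `lim_{t → 0} log_{1/t}(V)` of a set `V` of points with positive
coordinates. -/
def logLimitSet (V : Set (Fin n → ℝ)) : Set (Fin n → ℝ) :=
  {x | ∃ (y : ℕ → Fin n → ℝ) (t : ℕ → ℝ), (∀ k, y k ∈ V) ∧ (∀ k, t k ∈ Set.Ioo (0 : ℝ) 1) ∧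
    Tendsto t atTop (𝓝 0) ∧
    Tendsto (fun k i => Real.logb (1 / t k) (y k i)) atTop (𝓝 x)}

end RealTropical

end

/-!
Let `J = In_w(I)`. The rescaled polynomials `c^{-d} f(c^w · x)`, `f ∈ I` of weighted degree `d`,
converge to `In_w(f)` as `c → ∞`: the rescaled ideals form a family degenerating to `J`, and the
theorem says that a nonsingular real point of the special fibre lifts to nearby fibres.

Regularity of `(ℝ[x] / J)_p` is used once, in `exists_local_generators`: initial forms
`In_w(g_1), …, In_w(g_k)` whose gradients at `p` form a basis of the space of gradients of `J`
generate `J` locally at `p`. Indeed the maximal ideal of `(ℝ[x] / (In_w(g_i)))_p` has `n - k`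
generators, and this ring surjects onto `(ℝ[x] / J)_p`, of dimension `n - k` by regularity. A
Noetherian local ring whose maximal ideal has no more generators than the dimension is a domain
(`isDomain_of_card_generators_le`), so a nonzero kernel of the surjection would lower the dimension.

By the implicit function theorem (`exists_tendsto_zeros`) there are `x_c → p` such that
`g_1, …, g_k` vanish at `c^w · x_c`. It remains to see that all of `I` vanishes there. This is
Nakayama's lemma for the Rees algebra of the weight filtration, carried out with functions of `c`.
Take a finite standard basis `f_l` of `I` (`exists_finite_standard_basis`), and let
`v_l(c) = c^{-d_l} f_l(c^w · x_c)`. Locally at `p`, each `In_w(f_l)` is a combination of the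
`In_w(g_i)`; this relation holds between the rescaled polynomials up to terms of lower weighted
degree in `I`, which are combinations of the `v_l` with coefficients tending to zero
(`relation_mem_smallCombinations`). As the `g_i` vanish, each `v_l` is, up to a factor with nonzero
limit, a small combination of all of them, and a determinant argument gives `v_l(c) = 0` for large
`c`. The argument avoids any dimension theory for `I` and works for arbitrary real weights.

If all coordinates of `p` are nonzero, then `log_c |c^w · x_c| → w`, which gives the statement on
the logarithmic limit set.
-/

namespace RealTropical

open MvPolynomial

/-! ### Regular local rings are domains -/

open IsLocalRing in
theorem not_maximalIdeal_le_minimalPrime {R : Type*} [CommRing R] [IsLocalRing R]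
    (hdim : 1 ≤ ringKrullDim R) {q : Ideal R} (hq : q ∈ minimalPrimes R) :
    ¬ maximalIdeal R ≤ q := by
  intro hle
  have hqp : q.IsPrime := hq.1.1
  have heq : q = maximalIdeal R := le_antisymm (le_maximalIdeal hqp.ne_top) hle
  have h0 : (maximalIdeal R).height = 0 := by
    rw [← heq]
    exact Ideal.height_eq_zero_iff.mpr hq
  rw [← maximalIdeal_height_eq_ringKrullDim, h0] at hdim
  norm_num at hdim

open IsLocalRing in
/-- An element of `m \ m²` can replace one of the generators of `m`, so that modulo this element
the maximal ideal needs one generator less. -/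
theorem exists_finset_span_eq_maximalIdeal_quotient {R : Type*} [CommRing R] [IsLocalRing R]
    (s : Finset R) (hs : Ideal.span (s : Set R) = maximalIdeal R) {x : R}
    (hx : x ∈ maximalIdeal R) (hx2 : x ∉ maximalIdeal R ^ 2)
    [IsLocalRing (R ⧸ Ideal.span {x})] :
    ∃ t : Finset (R ⧸ Ideal.span {x}), t.card + 1 ≤ s.card ∧
      Ideal.span (t : Set (R ⧸ Ideal.span {x})) = maximalIdeal (R ⧸ Ideal.span {x}) := by
  classical
  have hx' := hx
  rw [← hs, Submodule.mem_span_finset'] at hx'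
  obtain ⟨a, ha⟩ := hx'
  obtain ⟨y, hy⟩ : ∃ y : s, IsUnit (a y) := by
    by_contra hcon
    push Not at hcon
    refine hx2 ?_
    rw [← ha, pow_two]
    refine Ideal.sum_mem _ fun y _ => Ideal.mul_mem_mul (hcon y) ?_
    rw [← hs]
    exact Ideal.subset_span y.2
  refine ⟨(s.erase y).image (Ideal.Quotient.mk _), ?_, ?_⟩
  · have h1 : (s.erase (y : R)).card + 1 = s.card := Finset.card_erase_add_one y.2
    have h2 := Finset.card_image_le (s := s.erase (y : R))
      (f := Ideal.Quotient.mk (Ideal.span {x}))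
    omega
  · have hmap : maximalIdeal (R ⧸ Ideal.span {x}) =
        (maximalIdeal R).map (Ideal.Quotient.mk (Ideal.span {x})) :=
      (map_maximalIdeal_of_surjective _ Ideal.Quotient.mk_surjective).symm
    rw [hmap, ← hs, Ideal.map_span]
    refine le_antisymm (Ideal.span_mono ?_) (Ideal.span_le.mpr ?_)
    · rw [Finset.coe_image]
      exact Set.image_mono (by simp)
    rintro _ ⟨z, hz, rfl⟩
    have hother : ∀ z ∈ s, z ≠ y → Ideal.Quotient.mk (Ideal.span {x}) z ∈
        Ideal.span (((s.erase (y : R)).image (Ideal.Quotient.mk (Ideal.span {x})) :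
          Finset (R ⧸ Ideal.span {x})) : Set (R ⧸ Ideal.span {x})) := by
      intro z hz hzy
      refine Ideal.subset_span ?_
      rw [Finset.coe_image]
      exact ⟨z, by simp [hzy, hz], rfl⟩
    by_cases hzy : z = y
    · subst hzy
      have h0 : Ideal.Quotient.mk (Ideal.span {x}) x = 0 :=
        Ideal.Quotient.eq_zero_iff_mem.mpr (Ideal.mem_span_singleton_self x)
      have ha2 := congrArg (Ideal.Quotient.mk (Ideal.span {x})) ha
      rw [h0, ← Finset.add_sum_erase _ _ (Finset.mem_univ y), map_add, smul_eq_mul,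
        map_mul] at ha2
      have hu : IsUnit (Ideal.Quotient.mk (Ideal.span {x}) (a y)) := hy.map _
      refine (Ideal.unit_mul_mem_iff_mem _ hu).mp ?_
      rw [eq_neg_of_add_eq_zero_left ha2, map_sum]
      refine neg_mem (Ideal.sum_mem _ fun z hz => ?_)
      rw [smul_eq_mul, map_mul]
      refine Ideal.mul_mem_left _ _ (hother z z.2 fun h => ?_)
      exact (Finset.mem_erase.mp hz).1 (Subtype.ext h)
    · exact hother z hz hzy

open IsLocalRing in
/-- A Noetherian local ring whose maximal ideal has a generating set of size at most the Krull
dimension is a domain: divide by an element of the maximal ideal outside its square and outside all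
minimal primes, and induct. -/
theorem isDomain_of_card_generators_le {R : Type*} [CommRing R] [IsNoetherianRing R]
    [IsLocalRing R] (d : ℕ) (s : Finset R) (hs : Ideal.span (s : Set R) = maximalIdeal R)
    (hcard : s.card ≤ d) (hdim : (d : WithBot ℕ∞) ≤ ringKrullDim R) : IsDomain R := by
  induction d generalizing R with
  | zero =>
    have hs0 : s = ∅ := by simpa using hcard
    rw [hs0, Finset.coe_empty, Ideal.span_empty] at hs
    exact (isField_iff_maximalIdeal_eq.mpr hs.symm).isDomain
  | succ d ih =>
    have hdim1 : 1 ≤ ringKrullDim R := le_trans (by exact_mod_cast Nat.le_add_left 1 d) hdim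
    obtain ⟨x, hx, hx2, hxq⟩ : ∃ x ∈ maximalIdeal R, x ∉ maximalIdeal R ^ 2 ∧
        ∀ q ∈ minimalPrimes R, x ∉ q := by
      -- Prime avoidance: otherwise `m ≤ m²`, so `m = 0`, or `m` is a minimal prime.
      by_contra hcon
      push Not at hcon
      have hsub : ((maximalIdeal R : Ideal R) : Set R) ⊆
          ⋃ i ∈ insert (maximalIdeal R ^ 2) (minimalPrimes R), ((id i : Ideal R) : Set R) := by
        intro x hx
        by_cases hx2 : x ∈ maximalIdeal R ^ 2
        · exact Set.mem_biUnion (Set.mem_insert _ _) hx2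
        · obtain ⟨q, hq, hxq⟩ := hcon x hx hx2
          exact Set.mem_biUnion (Set.mem_insert_of_mem _ hq) hxq
      rw [Ideal.subset_union_prime_finite
        ((minimalPrimes.finite_of_isNoetherianRing R).insert _) (maximalIdeal R ^ 2)
        (maximalIdeal R ^ 2)] at hsub
      · obtain ⟨q, hq, hle⟩ := hsub
        rcases hq with rfl | hq
        · have hbot : maximalIdeal R = ⊥ :=
            Submodule.eq_bot_of_le_smul_of_le_jacobson_bot (maximalIdeal R) (maximalIdeal R)
              (IsNoetherian.noetherian _)
              (by simpa [pow_two, smul_eq_mul] using hle) (maximalIdeal_le_jacobson _)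
          obtain ⟨q, hq⟩ := Ideal.nonempty_minimalPrimes (I := (⊥ : Ideal R)) bot_ne_top
          exact not_maximalIdeal_le_minimalPrime hdim1 hq (hbot ▸ bot_le)
        · exact not_maximalIdeal_le_minimalPrime hdim1 hq hle
      · intro i hi h1 _
        rcases hi with rfl | hi
        · exact absurd rfl h1
        · exact hi.1.1
    have hne : Ideal.span {x} ≠ ⊤ := fun h => (maximalIdeal.isMaximal R).ne_top
      (top_le_iff.mp (h ▸ (Ideal.span_singleton_le_iff_mem _).mpr hx))
    have : Nontrivial (R ⧸ Ideal.span {x}) := Ideal.Quotient.nontrivial_iff.mpr hne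
    have : IsLocalRing (R ⧸ Ideal.span {x}) :=
      IsLocalRing.of_surjective' (Ideal.Quotient.mk _) Ideal.Quotient.mk_surjective
    obtain ⟨t, htc, ht⟩ := exists_finset_span_eq_maximalIdeal_quotient s hs hx hx2
    have hdim' : (d : WithBot ℕ∞) ≤ ringKrullDim (R ⧸ Ideal.span {x}) := by
      have h := ringKrullDim_le_ringKrullDim_quotient_add_card ({x} : Finset R) (by
        rw [Finset.coe_singleton, Set.singleton_subset_iff, ringJacobson_eq_maximalIdeal]
        exact hx)
      rw [Finset.coe_singleton, Finset.card_singleton] at h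
      have h2 := hdim.trans h
      push_cast at h2
      exact ENat.WithBot.add_le_add_one_right_iff.mp h2
    have hdom : IsDomain (R ⧸ Ideal.span {x}) := ih t ht (by omega) hdim'
    have hprime : (Ideal.span {x}).IsPrime := (Ideal.Quotient.isDomain_iff_prime _).mp hdom
    -- A minimal prime `q ≤ (x)` does not contain `x`, so `q = x q`, and Nakayama gives `q = 0`.
    obtain ⟨q, hq, hqx⟩ := Ideal.exists_minimalPrimes_le (I := ⊥) (J := Ideal.span {x}) bot_le
    have hqp : q.IsPrime := hq.1.1
    have hbot : q = ⊥ := by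
      refine Submodule.eq_bot_of_le_smul_of_le_jacobson_bot (maximalIdeal R) q
        (IsNoetherian.noetherian _) (fun y hy => ?_) (maximalIdeal_le_jacobson _)
      obtain ⟨z, rfl⟩ := Ideal.mem_span_singleton.mp (hqx hy)
      exact Ideal.mul_mem_mul hx ((hqp.mem_or_mem hy).resolve_left (hxq q hq))
    subst hbot
    exact IsDomain.of_bot_isPrime R

open IsLocalRing in
/-- A surjection from a local ring whose maximal ideal has at most `d` generators onto a ring of
Krull dimension at least `d` is injective: the source is a domain, so that a nonzero kernel would
lower the dimension. -/
theorem injective_of_surjective_of_le_ringKrullDim {R S : Type*} [CommRing R] [CommRing S]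
    [IsNoetherianRing R] [IsLocalRing R] (f : R →+* S) (hf : Function.Surjective f) (d : ℕ)
    (s : Finset R) (hs : Ideal.span (s : Set R) = maximalIdeal R) (hcard : s.card ≤ d)
    (hdim : (d : WithBot ℕ∞) ≤ ringKrullDim S) : Function.Injective f := by
  have hdomain : IsDomain R := isDomain_of_card_generators_le d s hs hcard
    (hdim.trans (ringKrullDim_le_of_surjective f hf))
  refine (injective_iff_map_eq_zero f).mpr fun r hr => ?_
  by_contra hr0
  have h1 := ringKrullDim_succ_le_of_surjective f hf (mem_nonZeroDivisors_of_ne_zero hr0) hr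
  have h2 : ringKrullDim R ≤ d := by
    refine (ringKrullDim_le_spanFinrank_maximalIdeal R).trans ?_
    have h3 : (maximalIdeal R).spanFinrank ≤ (s : Set R).ncard := by
      rw [← hs]
      exact Submodule.spanFinrank_span_le_ncard_of_finite s.finite_toSet
    rw [Set.ncard_coe_finset] at h3
    exact_mod_cast h3.trans hcard
  have h4 : (d : WithBot ℕ∞) + 1 ≤ d := (add_le_add_left hdim 1).trans (h1.trans h2)
  have h5 : d + 1 ≤ d := by exact_mod_cast h4
  omega

/-! ### Local generators at a regular point -/

/-- The gradient `(∂f/∂x_i (p))_i` of `f` at `p`, as a linear function of `f`. -/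
noncomputable def gradientAt {n : ℕ} (p : Fin n → ℝ) :
    MvPolynomial (Fin n) ℝ →ₗ[ℝ] (Fin n → ℝ) where
  toFun f i := eval p (pderiv i f)
  map_add' f g := by ext i; simp
  map_smul' c f := by ext i; simp [smul_eval]

theorem gradientAt_mul {n : ℕ} (p : Fin n → ℝ) (f g : MvPolynomial (Fin n) ℝ) :
    gradientAt p (f * g) = eval p f • gradientAt p g + eval p g • gradientAt p f := by
  ext i
  simp only [gradientAt, LinearMap.coe_mk, AddHom.coe_mk, Derivation.leibniz, smul_eq_mul, map_add,
    map_mul, Pi.add_apply, Pi.smul_apply]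

/-- The polynomial `∑ v_i (x_i - p_i)`. -/
noncomputable def linearFormAt {n : ℕ} (p : Fin n → ℝ) :
    (Fin n → ℝ) →ₗ[ℝ] MvPolynomial (Fin n) ℝ :=
  Fintype.linearCombination ℝ fun i => X i - C (p i)

theorem mem_pointIdeal {n : ℕ} {p : Fin n → ℝ} {f : MvPolynomial (Fin n) ℝ} :
    f ∈ pointIdeal p ↔ eval p f = 0 := RingHom.mem_ker

theorem X_sub_C_mem_pointIdeal {n : ℕ} (p : Fin n → ℝ) (i : Fin n) :
    X i - C (p i) ∈ pointIdeal p := by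
  simp [mem_pointIdeal]

theorem linearFormAt_single {n : ℕ} (p : Fin n → ℝ) (i : Fin n) (a : ℝ) :
    linearFormAt p (Pi.single i a) = a • (X i - C (p i)) := by
  simp [linearFormAt, Fintype.linearCombination_apply_single]

theorem linearFormAt_mem_pointIdeal {n : ℕ} (p v : Fin n → ℝ) :
    linearFormAt p v ∈ pointIdeal p := by
  rw [linearFormAt, Fintype.linearCombination_apply]
  refine Ideal.sum_mem _ fun i _ => ?_
  rw [smul_eq_C_mul]
  exact Ideal.mul_mem_left _ _ (X_sub_C_mem_pointIdeal p i)

theorem gradientAt_C {n : ℕ} (p : Fin n → ℝ) (a : ℝ) : gradientAt p (C a) = 0 := by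
  ext i
  simp [gradientAt]

theorem gradientAt_X {n : ℕ} (p : Fin n → ℝ) (i : Fin n) :
    gradientAt p (X i) = Pi.single i 1 := by
  ext j
  simp [gradientAt, pderiv_X, Pi.single_apply, eq_comm, apply_ite]

theorem gradientAt_X_sub_C {n : ℕ} (p : Fin n → ℝ) (i : Fin n) :
    gradientAt p (X i - C (p i)) = Pi.single i 1 := by
  rw [map_sub, gradientAt_X, gradientAt_C, sub_zero]

/-- Taylor expansion of first order at `p`. -/
theorem sub_linearFormAt_mem_sq {n : ℕ} (p : Fin n → ℝ) (f : MvPolynomial (Fin n) ℝ) :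
    f - C (eval p f) - linearFormAt p (gradientAt p f) ∈ pointIdeal p ^ 2 := by
  induction f using MvPolynomial.induction_on with
  | C a =>
    simp [gradientAt_C]
  | add f g hf hg =>
    have h := add_mem hf hg
    rw [map_add, map_add, map_add, map_add]
    convert h using 1
    ring
  | mul_X f i hf =>
    rw [gradientAt_mul, gradientAt_X, map_add, map_smul, map_smul, linearFormAt_single, map_mul,
      eval_X, C_mul, one_smul, smul_eq_C_mul, smul_eq_C_mul]
    have h1 : (f - C (eval p f) - linearFormAt p (gradientAt p f)) * X i ∈ pointIdeal p ^ 2 :=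
      Ideal.mul_mem_right _ _ hf
    have h2 : linearFormAt p (gradientAt p f) * (X i - C (p i)) ∈ pointIdeal p ^ 2 := by
      rw [pow_two]
      exact Ideal.mul_mem_mul (linearFormAt_mem_pointIdeal _ _) (X_sub_C_mem_pointIdeal _ _)
    convert add_mem h1 h2 using 1
    ring

theorem gradientAt_mem_of_mem_span {n : ℕ} (p : Fin n → ℝ) {G : Set (MvPolynomial (Fin n) ℝ)}
    {W : Submodule ℝ (Fin n → ℝ)} (hp : ∀ g ∈ G, eval p g = 0) (hW : ∀ g ∈ G, gradientAt p g ∈ W)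
    {f : MvPolynomial (Fin n) ℝ} (hf : f ∈ Ideal.span G) : gradientAt p f ∈ W := by
  have key : eval p f = 0 ∧ gradientAt p f ∈ W := by
    induction hf using Submodule.span_induction with
    | mem g hg => exact ⟨hp g hg, hW g hg⟩
    | zero => simp
    | add f g _ _ hf hg => exact ⟨by simp [hf.1, hg.1], by rw [map_add]; exact W.add_mem hf.2 hg.2⟩
    | smul a f _ hf =>
      refine ⟨by simp [hf.1], ?_⟩
      rw [smul_eq_mul, gradientAt_mul, hf.1, zero_smul, add_zero]
      exact W.smul_mem _ hf.2
  exact key.2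

open IsLocalRing in
/-- If the gradients at `p` of the elements of `J` lie in a space `W` of dimension `k`, then the
maximal ideal of `(ℝ[x] / J)_p` has at least `n - k` generators; if this ring is regular, its
dimension is thus at least `n - k`. -/
theorem le_ringKrullDim_localRingAt {n : ℕ} (p : Fin n → ℝ) (G : Set (MvPolynomial (Fin n) ℝ))
    (hp : ∀ g ∈ G, eval p g = 0) (W : Submodule ℝ (Fin n → ℝ)) (hW : ∀ g ∈ G, gradientAt p g ∈ W)
    (hreg : IsRegularLocalRing (LocalRingAt (Ideal.span G) p)) :
    ((n - Module.finrank ℝ W : ℕ) : WithBot ℕ∞) ≤ ringKrullDim (LocalRingAt (Ideal.span G) p) := by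
  classical
  set J := Ideal.span G with hJ
  set R := Localization.AtPrime (pointIdeal p)
  set K := J.map (algebraMap (MvPolynomial (Fin n) ℝ) R) with hK
  have : IsLocalRing (LocalRingAt J p) := hreg.toIsLocalRing
  refine le_of_le_of_eq ?_ (hreg.spanFinrank_maximalIdeal (R := LocalRingAt J p))
  obtain ⟨s, hs, hspan⟩ := Submodule.FG.exists_span_finset_card_eq_spanFinrank
    (IsNoetherian.noetherian (maximalIdeal (LocalRingAt J p)))
  rw [← hs]
  suffices n ≤ Module.finrank ℝ W + s.card by
    have h : n - Module.finrank ℝ W ≤ s.card := by omega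
    exact_mod_cast h
  have hmap : maximalIdeal (LocalRingAt J p) = (maximalIdeal R).map (Ideal.Quotient.mk K) :=
    (map_maximalIdeal_of_surjective _ Ideal.Quotient.mk_surjective).symm
  -- Up to units of `R`, the generators come from polynomials vanishing at `p`.
  have hlift : ∀ y : s, ∃ (a : MvPolynomial (Fin n) ℝ) (b : (pointIdeal p).primeCompl),
      Ideal.Quotient.mk K (IsLocalization.mk' R a b) = y ∧ eval p a = 0 := by
    intro y
    obtain ⟨r, hr⟩ := Ideal.Quotient.mk_surjective (y : LocalRingAt J p)
    obtain ⟨a, b, rfl⟩ := IsLocalization.exists_mk'_eq (pointIdeal p).primeCompl r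
    refine ⟨a, b, hr, ?_⟩
    have hy : (y : LocalRingAt J p) ∈ maximalIdeal (LocalRingAt J p) := by
      rw [← hspan]
      exact Submodule.subset_span y.2
    rw [← hr] at hy
    have hy2 : IsLocalization.mk' R a b ∈ maximalIdeal R := by
      rw [mem_maximalIdeal, mem_nonunits_iff] at hy ⊢
      exact fun h => hy (h.map _)
    rw [IsLocalization.AtPrime.mk'_mem_maximal_iff R (pointIdeal p)] at hy2
    exact mem_pointIdeal.mp hy2
  choose a b hab ha0 using hlift
  set A := Set.range a
  have hle : maximalIdeal R ≤ (J ⊔ Ideal.span A).map (algebraMap _ R) := by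
    have h1 : maximalIdeal R ≤ K ⊔ Ideal.span ((algebraMap (MvPolynomial (Fin n) ℝ) R) '' A) := by
      have h2 : maximalIdeal (LocalRingAt J p) ≤
          (Ideal.span ((algebraMap (MvPolynomial (Fin n) ℝ) R) '' A)).map
            (Ideal.Quotient.mk K) := by
        rw [← hspan]
        refine Submodule.span_le.mpr fun y hy => ?_
        have hy2 := hab ⟨y, hy⟩
        change _ = y at hy2
        rw [← hy2]
        refine Ideal.mem_map_of_mem _ ?_
        rw [IsLocalization.mk'_eq_mul_mk'_one]
        exact Ideal.mul_mem_right _ _ (Ideal.subset_span ⟨_, ⟨_, rfl⟩, rfl⟩)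
      rw [hmap, Ideal.map_le_iff_le_comap, Ideal.comap_map_of_surjective _
        Ideal.Quotient.mk_surjective, ← RingHom.ker_eq_comap_bot, Ideal.mk_ker] at h2
      rwa [sup_comm]
    rwa [Ideal.map_sup, Ideal.map_span _ A]
  have htop : (⊤ : Submodule ℝ (Fin n → ℝ)) ≤
      W ⊔ Submodule.span ℝ (Set.range (gradientAt p ∘ a)) := by
    intro v _
    rw [pi_eq_sum_univ' v]
    -- Some `u` with `u(p) ≠ 0` puts `u (x_i - p_i)` into `J + (a)`; its gradient is `u(p) e_i`.
    refine Submodule.sum_mem _ fun i _ => Submodule.smul_mem _ _ ?_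
    have h1 : algebraMap _ R (X i - C (p i)) ∈ (J ⊔ Ideal.span A).map (algebraMap _ R) := by
      refine hle ?_
      rw [← Localization.AtPrime.map_eq_maximalIdeal]
      exact Ideal.mem_map_of_mem _ (X_sub_C_mem_pointIdeal p i)
    rw [IsLocalization.algebraMap_mem_map_algebraMap_iff (pointIdeal p).primeCompl] at h1
    obtain ⟨u, hu, hmem⟩ := h1
    rw [hJ, ← Ideal.span_union] at hmem
    have h2 := gradientAt_mem_of_mem_span p
      (W := W ⊔ Submodule.span ℝ (Set.range (gradientAt p ∘ a)))
      (by rintro g (hg | ⟨y, rfl⟩); exacts [hp g hg, ha0 y])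
      (by
        rintro g (hg | ⟨y, rfl⟩)
        · exact Submodule.mem_sup_left (hW g hg)
        · exact Submodule.mem_sup_right (Submodule.subset_span ⟨y, rfl⟩)) hmem
    rw [gradientAt_mul, gradientAt_X_sub_C] at h2
    have hu0 : eval p u ≠ 0 := fun h => hu (mem_pointIdeal.mpr h)
    have h3 : eval p (X i - C (p i)) = 0 := by simp
    rw [h3, zero_smul, add_zero] at h2
    have h4 := (Submodule.smul_mem_iff _ hu0).mp h2
    convert h4 using 1
  have hfin := Submodule.finrank_mono htop
  rw [finrank_top, Module.finrank_fin_fun] at hfin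
  refine hfin.trans ((Submodule.finrank_add_le_finrank_add_finrank _ _).trans ?_)
  refine Nat.add_le_add_left ((finrank_range_le_card _).trans ?_) _
  simp

open IsLocalRing in
/-- Modulo polynomials vanishing at `p` whose gradients there span a space of dimension `k`, the
maximal ideal of the local ring of affine space at `p` is generated by `n - k` linear forms, which
span a complement of the differentials of these polynomials. -/
theorem exists_generators_maximalIdeal_quotient {n : ℕ} (p : Fin n → ℝ)
    (G : Set (MvPolynomial (Fin n) ℝ)) (hp : ∀ g ∈ G, eval p g = 0)
    [IsLocalRing (LocalRingAt (Ideal.span G) p)] :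
    ∃ s : Finset (LocalRingAt (Ideal.span G) p),
      Ideal.span (s : Set (LocalRingAt (Ideal.span G) p)) =
        maximalIdeal (LocalRingAt (Ideal.span G) p) ∧
      s.card ≤ n - Module.finrank ℝ (Submodule.span ℝ (gradientAt p '' G)) := by
  classical
  set W := Submodule.span ℝ (gradientAt p '' G)
  obtain ⟨V, hV⟩ := Submodule.exists_isCompl W
  set e := Module.finBasis ℝ V
  set l : Fin (Module.finrank ℝ V) → MvPolynomial (Fin n) ℝ := fun j => linearFormAt p (e j)
  set A := Ideal.span G ⊔ Ideal.span (Set.range l) ⊔ pointIdeal p ^ 2 with hA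
  have hlin : ∀ v, linearFormAt p v ∈ A := by
    have htop : (⊤ : Submodule ℝ (Fin n → ℝ)) ≤
        (A.restrictScalars ℝ).comap (linearFormAt p) := by
      rw [← hV.sup_eq_top]
      refine sup_le (Submodule.span_le.mpr ?_) ?_
      · rintro _ ⟨g, hg, rfl⟩
        have h1 := sub_linearFormAt_mem_sq p g
        rw [hp g hg, C_0, sub_zero] at h1
        have h2 : g ∈ A := Submodule.mem_sup_left (Submodule.mem_sup_left (Ideal.subset_span hg))
        have h3 := sub_mem h2 (Submodule.mem_sup_right h1 : _ ∈ A)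
        simpa using h3
      · intro v hv
        have h1 : v = ∑ j, e.repr ⟨v, hv⟩ j • (e j : Fin n → ℝ) := by
          have h := congrArg V.subtype (e.sum_repr ⟨v, hv⟩)
          simp only [map_sum, map_smul, Submodule.subtype_apply] at h
          exact h.symm
        rw [h1]
        refine Submodule.sum_mem _ fun j _ => Submodule.smul_mem _ _ ?_
        exact Submodule.mem_sup_left (Submodule.mem_sup_right (Ideal.subset_span ⟨j, rfl⟩))
    exact fun v => htop (Submodule.mem_top (x := v))
  have hpA : pointIdeal p ≤ A := by
    intro f hf
    have h1 := sub_linearFormAt_mem_sq p f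
    rw [mem_pointIdeal.mp hf, C_0, sub_zero] at h1
    have h2 := add_mem (Submodule.mem_sup_right h1 : _ ∈ A) (hlin (gradientAt p f))
    simpa using h2
  set R := Localization.AtPrime (pointIdeal p)
  set φ := algebraMap (MvPolynomial (Fin n) ℝ) R
  have hmR : maximalIdeal R ≤ (Ideal.span G).map φ ⊔ (Ideal.span (Set.range l)).map φ := by
    refine Submodule.le_of_le_smul_of_le_jacobson_bot (I := maximalIdeal R)
      (IsNoetherian.noetherian _) (maximalIdeal_le_jacobson _) ?_
    have h := Ideal.map_mono (f := φ) hpA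
    rw [hA, Ideal.map_sup, Ideal.map_sup, Ideal.map_pow,
      Localization.AtPrime.map_eq_maximalIdeal, pow_two] at h
    exact h
  have hmap : maximalIdeal (LocalRingAt (Ideal.span G) p) =
      (maximalIdeal R).map (Ideal.Quotient.mk ((Ideal.span G).map φ)) :=
    (map_maximalIdeal_of_surjective _ Ideal.Quotient.mk_surjective).symm
  refine ⟨Finset.univ.image fun j => Ideal.Quotient.mk ((Ideal.span G).map φ) (φ (l j)), ?_, ?_⟩
  · have hrange : ((Finset.univ.image fun j => Ideal.Quotient.mk ((Ideal.span G).map φ) (φ (l j)) :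
        Finset (LocalRingAt (Ideal.span G) p)) : Set (LocalRingAt (Ideal.span G) p)) =
        (Ideal.Quotient.mk ((Ideal.span G).map φ)) '' (φ '' Set.range l) := by
      rw [Finset.coe_image, Finset.coe_univ, Set.image_univ, ← Set.range_comp, ← Set.range_comp]
      rfl
    rw [hrange, ← Ideal.map_span, ← Ideal.map_span, hmap]
    refine le_antisymm (Ideal.map_mono ?_) ?_
    · rw [← Localization.AtPrime.map_eq_maximalIdeal]
      refine Ideal.map_mono (Ideal.span_le.mpr ?_)
      rintro _ ⟨j, rfl⟩
      exact linearFormAt_mem_pointIdeal _ _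
    · refine (Ideal.map_mono hmR).trans ?_
      rw [Ideal.map_sup, Ideal.map_quotient_self, bot_sup_eq]
  · refine Finset.card_image_le.trans ?_
    have h := Submodule.finrank_add_eq_of_isCompl hV
    rw [Module.finrank_fin_fun] at h
    rw [Finset.card_univ, Fintype.card_fin]
    omega

/-- If `(ℝ[x] / J)_p` is regular, then any generators of `J` whose gradients at `p` form a basis of
the space spanned by all gradients of `J` at `p` generate `J` in a neighbourhood of `p`. -/
theorem exists_local_generators {n : ℕ} (p : Fin n → ℝ) (G : Set (MvPolynomial (Fin n) ℝ))
    (hp : ∀ g ∈ G, eval p g = 0) (hreg : IsRegularLocalRing (LocalRingAt (Ideal.span G) p)) :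
    ∃ (κ : Type) (_ : Fintype κ) (g : κ → MvPolynomial (Fin n) ℝ), (∀ i, g i ∈ G) ∧
      LinearIndependent ℝ (fun i => gradientAt p (g i)) ∧
      ∀ h ∈ Ideal.span G, ∃ u, eval p u ≠ 0 ∧ u * h ∈ Ideal.span (Set.range g) := by
  obtain ⟨κ, a, -, hspan, hli⟩ := exists_linearIndependent' ℝ fun g : G => gradientAt p (g : _)
  have hfin : Finite κ := hli.finite
  let _ : Fintype κ := Fintype.ofFinite κ
  set g : κ → MvPolynomial (Fin n) ℝ := fun i => (a i : MvPolynomial (Fin n) ℝ)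
  refine ⟨κ, inferInstance, g, fun i => (a i).2, hli, fun h hh => ?_⟩
  have hgG : Set.range g ⊆ G := by rintro _ ⟨i, rfl⟩; exact (a i).2
  have hgp : ∀ f ∈ Set.range g, eval p f = 0 := fun f hf => hp f (hgG hf)
  set W := Submodule.span ℝ (gradientAt p '' Set.range g)
  have hW : W = Submodule.span ℝ (Set.range fun g : G => gradientAt p (g : _)) := by
    rw [← hspan]
    simp only [W, ← Set.range_comp]
    rfl
  set φ := algebraMap (MvPolynomial (Fin n) ℝ) (Localization.AtPrime (pointIdeal p))
  have hle : (Ideal.span (Set.range g)).map φ ≤ (Ideal.span G).map φ :=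
    Ideal.map_mono (Ideal.span_mono hgG)
  have hsurj : Function.Surjective (Ideal.Quotient.factor hle) :=
    Ideal.Quotient.factor_surjective hle
  have : Nontrivial (LocalRingAt (Ideal.span (Set.range g)) p) := hsurj.nontrivial
  have : IsLocalRing (LocalRingAt (Ideal.span (Set.range g)) p) :=
    IsLocalRing.of_surjective' (Ideal.Quotient.mk _) Ideal.Quotient.mk_surjective
  obtain ⟨s, hs, hcard⟩ := exists_generators_maximalIdeal_quotient p (Set.range g) hgp
  have hdim := le_ringKrullDim_localRingAt p G hp W
    (fun f hf => by rw [hW]; exact Submodule.subset_span ⟨⟨f, hf⟩, rfl⟩) hreg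
  have hinj := injective_of_surjective_of_le_ringKrullDim
    (S := LocalRingAt (Ideal.span G) p) (Ideal.Quotient.factor hle) hsurj _ s hs
    hcard hdim
  have hmem : φ h ∈ (Ideal.span (Set.range g)).map φ := by
    rw [← Ideal.Quotient.eq_zero_iff_mem]
    refine (injective_iff_map_eq_zero _).mp hinj _ ?_
    rw [Ideal.Quotient.factor_mk, Ideal.Quotient.eq_zero_iff_mem]
    exact Ideal.mem_map_of_mem _ hh
  rw [IsLocalization.algebraMap_mem_map_algebraMap_iff (pointIdeal p).primeCompl] at hmem
  obtain ⟨u, hu, hmem⟩ := hmem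
  exact ⟨u, fun h0 => hu (mem_pointIdeal.mpr h0), hmem⟩

/-! ### Finite standard bases -/

theorem wDegree_le_iff {n : ℕ} {w : Fin n → ℝ} {f : MvPolynomial (Fin n) ℝ} {d : ℝ} :
    wDegree w f ≤ d ↔ ∀ a ∈ f.support, Finsupp.weight w a ≤ d := by
  simp [wDegree, weightedTotalDegree', Finset.sup_le_iff]

/-- The weight of an exponent, with ties broken lexicographically. The induced order on exponents
is total and translation invariant, but in general not a well-order, since weights may be
negative. -/
noncomputable def weightLex {n : ℕ} (w : Fin n → ℝ) (a : Fin n →₀ ℕ) :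
    ℝ ×ₗ Lex (Fin n →₀ ℕ) :=
  toLex (Finsupp.weight w a, toLex a)

theorem weightLex_injective {n : ℕ} (w : Fin n → ℝ) : Function.Injective (weightLex w) :=
  fun _ _ h => toLex.injective (congrArg Prod.snd (toLex.injective h))

theorem weightLex_add {n : ℕ} (w : Fin n → ℝ) (a b : Fin n →₀ ℕ) :
    weightLex w (a + b) = weightLex w a + weightLex w b := by
  simp only [weightLex, map_add, toLex_add, ← Prod.mk_add_mk]

theorem weight_le_of_weightLex_le {n : ℕ} {w : Fin n → ℝ} {a b : Fin n →₀ ℕ}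
    (h : weightLex w a ≤ weightLex w b) : Finsupp.weight w a ≤ Finsupp.weight w b :=
  Prod.Lex.monotone_fst _ _ h

/-- `a` is the leading exponent of `f`, for the weight order refined lexicographically. -/
def IsLeading {n : ℕ} (w : Fin n → ℝ) (f : MvPolynomial (Fin n) ℝ) (a : Fin n →₀ ℕ) : Prop :=
  a ∈ f.support ∧ ∀ b ∈ f.support, weightLex w b ≤ weightLex w a

theorem exists_isLeading {n : ℕ} (w : Fin n → ℝ) {f : MvPolynomial (Fin n) ℝ} (hf : f ≠ 0) :
    ∃ a, IsLeading w f a :=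
  Finset.exists_max_image f.support (weightLex w) (support_nonempty.mpr hf)

theorem IsLeading.wDegree_eq {n : ℕ} {w : Fin n → ℝ} {f : MvPolynomial (Fin n) ℝ}
    {a : Fin n →₀ ℕ} (h : IsLeading w f a) : wDegree w f = (Finsupp.weight w a : ℝ) := by
  refine le_antisymm (wDegree_le_iff.mpr fun b hb => weight_le_of_weightLex_le (h.2 b hb)) ?_
  exact Finset.le_sup (f := fun s => (Finsupp.weight w s : WithBot ℝ)) h.1

theorem exists_add_of_mem_support_monomial_mul {n : ℕ} {c : Fin n →₀ ℕ} {r : ℝ}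
    {f : MvPolynomial (Fin n) ℝ} {b : Fin n →₀ ℕ} (hb : b ∈ (monomial c r * f).support) :
    ∃ b₀ ∈ f.support, b = c + b₀ := by
  rw [mem_support_iff, coeff_monomial_mul'] at hb
  have hcb : c ≤ b := by
    by_contra h
    simp [h] at hb
  rw [if_pos hcb] at hb
  exact ⟨b - c, mem_support_iff.mpr (right_ne_zero_of_mul hb), (add_tsub_cancel_of_le hcb).symm⟩

/-- One step of the division algorithm: cancelling the leading term of `g` by a multiple of `f`. -/
theorem IsLeading.lt_of_mem_support_sub {n : ℕ} {w : Fin n → ℝ} {f g : MvPolynomial (Fin n) ℝ}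
    {a c : Fin n →₀ ℕ} (hg : IsLeading w g (c + a)) (hf : IsLeading w f a) {b : Fin n →₀ ℕ}
    (hb : b ∈ (g - monomial c (coeff (c + a) g / coeff a f) * f).support) :
    weightLex w b < weightLex w (c + a) := by
  classical
  refine lt_of_le_of_ne ?_ fun h => ?_
  · rcases Finset.mem_union.mp (support_sub _ _ _ hb) with hb | hb
    · exact hg.2 b hb
    · obtain ⟨b₀, hb₀, rfl⟩ := exists_add_of_mem_support_monomial_mul hb
      rw [weightLex_add, weightLex_add]
      exact add_le_add_right (hf.2 b₀ hb₀) _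
  · rw [weightLex_injective w h, mem_support_iff, coeff_sub, coeff_monomial_mul,
      div_mul_cancel₀ _ (mem_support_iff.mp hf.1), sub_self] at hb
    exact hb rfl

/-- The family `f` in `I`, with weighted degrees `D`, is a standard basis: each `g ∈ I` of weighted
degree at most `d` is a combination of terms `x^b f_l` of weighted degree at most `d`. -/
structure IsStandardBasis {n : ℕ} (w : Fin n → ℝ) (I : Ideal (MvPolynomial (Fin n) ℝ)) {ι : Type*}
    (f : ι → MvPolynomial (Fin n) ℝ) (D : ι → ℝ) : Prop where
  mem : ∀ l, f l ∈ I
  wDegree_eq : ∀ l, wDegree w (f l) = D l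
  mem_span : ∀ g ∈ I, ∀ d : ℝ, wDegree w g ≤ d → g ∈ Submodule.span ℝ
    {q | ∃ l b, Finsupp.weight w b + D l ≤ d ∧ q = monomial b (1 : ℝ) * f l}

/-- Every ideal has a finite standard basis. As weights may be negative, reduction of leading terms
alone need not terminate. The pairs `(a, e)` with `a` a leading exponent of an `f ∈ I` of total
degree at most `e + |a|` correspond to leading exponents of the homogenization of `I`; by Dickson's
lemma, finitely many of them are minimal, and reduction by these keeps the total degree bounded. -/
theorem exists_finite_standard_basis {n : ℕ} (w : Fin n → ℝ) (I : Ideal (MvPolynomial (Fin n) ℝ)) :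
    ∃ (ι : Type) (_ : Fintype ι) (f : ι → MvPolynomial (Fin n) ℝ) (D : ι → ℝ),
      IsStandardBasis w I f D := by
  set S : (Fin n →₀ ℕ) × ℕ → Prop := fun s =>
    ∃ f ∈ I, IsLeading w f s.1 ∧ f.totalDegree ≤ s.2 + s.1.degree
  have hfin : {s | Minimal S s}.Finite :=
    WellQuasiOrderedLE.finite_of_isAntichain (setOfPred_minimal_antichain S)
  have hS : ∀ s : {s | Minimal S s}, S s := fun s => s.2.prop
  choose f hfI hlead hdeg using hS
  refine ⟨{s | Minimal S s}, hfin.fintype, f, fun s => Finsupp.weight w s.1.1, hfI,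
    fun l => (hlead l).wDegree_eq, fun g hg d hd => ?_⟩
  set M := Submodule.span ℝ {q | ∃ (l : {s | Minimal S s}) (b : Fin n →₀ ℕ),
    Finsupp.weight w b + Finsupp.weight w l.1.1 ≤ d ∧ q = monomial b (1 : ℝ) * f l} with hM
  set N := g.totalDegree
  have hT : Finite {a : Fin n →₀ ℕ // a.degree ≤ N} := Finsupp.finite_of_degree_le N
  have hdegree : ∀ {h : MvPolynomial (Fin n) ℝ} {a}, h.totalDegree ≤ N → a ∈ h.support →
      a.degree ≤ N := fun hh ha => (le_totalDegree ha).trans hh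
  -- Induction on the leading exponent, among the finitely many exponents of degree at most `N`.
  have key : ∀ a : {a : Fin n →₀ ℕ // a.degree ≤ N}, ∀ h ∈ I, h.totalDegree ≤ N →
      wDegree w h ≤ d → IsLeading w h a → h ∈ M := by
    have hwf : WellFounded (InvImage (· < ·)
        fun a : {a : Fin n →₀ ℕ // a.degree ≤ N} => weightLex w (a : Fin n →₀ ℕ)) :=
      Finite.wellFounded_of_trans_of_irrefl _
    intro a
    induction a using hwf.induction with
    | h a ih =>
      intro h hh hN hhd ha
      have hSa : S (a.1, N - a.1.degree) := ⟨h, hh, ha, by have := a.2; simp only; omega⟩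
      obtain ⟨s, hsle, hs⟩ := exists_minimal_le_of_wellFoundedLT S _ hSa
      set l : {s | Minimal S s} := ⟨s, hs⟩
      obtain ⟨c, hc⟩ : ∃ c, (a : Fin n →₀ ℕ) = c + s.1 := ⟨_, (tsub_add_cancel_of_le hsle.1).symm⟩
      have hca : c.degree + s.1.degree = a.1.degree := by rw [hc, map_add]
      set r := coeff (c + s.1) h / coeff s.1 (f l)
      have hlt : ∀ b ∈ (h - monomial c r * f l).support, weightLex w b < weightLex w a := by
        intro b hb
        rw [hc] at ha ⊢
        exact ha.lt_of_mem_support_sub (hlead l) hb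
      have hterm : monomial c r * f l ∈ M := by
        have h1 : monomial c r * f l = r • (monomial c (1 : ℝ) * f l) := by
          rw [← smul_mul_assoc, smul_monomial, smul_eq_mul, mul_one]
        rw [h1]
        refine M.smul_mem _ (Submodule.subset_span ⟨l, c, ?_, rfl⟩)
        rw [← map_add, ← hc]
        exact wDegree_le_iff.mp hhd _ ha.1
      suffices h - monomial c r * f l ∈ M by simpa using M.add_mem this hterm
      by_cases h0 : h - monomial c r * f l = 0
      · rw [h0]
        exact M.zero_mem
      obtain ⟨b, hb⟩ := exists_isLeading w h0
      have hN' : (h - monomial c r * f l).totalDegree ≤ N := by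
        refine (totalDegree_sub _ _).trans (max_le hN ?_)
        refine (totalDegree_mul _ _).trans ?_
        have h1 := totalDegree_monomial_le c r
        have h2 := hdeg l
        have h3 : s.2 ≤ N - a.1.degree := hsle.2
        have h4 := a.2
        change (f l).totalDegree ≤ s.2 + s.1.degree at h2
        change _ ≤ c.degree at h1
        omega
      refine ih ⟨b, hdegree hN' hb.1⟩ (hlt b hb.1) _ (I.sub_mem hh (I.mul_mem_left _ (hfI l))) hN'
        (wDegree_le_iff.mpr fun b hb => ?_) hb
      exact (weight_le_of_weightLex_le (hlt b hb).le).trans (wDegree_le_iff.mp hhd _ ha.1)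
  by_cases h0 : g = 0
  · rw [h0]
    exact M.zero_mem
  obtain ⟨a, ha⟩ := exists_isLeading w h0
  exact key ⟨a, hdegree le_rfl ha.1⟩ g hg le_rfl hd ha

/-! ### Degeneration and lifting of zeros -/

/-- The family of functions `∑ f_a s^{θ (d - wᵀa)} x^a`, with parameter `s`, joining the rescalings
of `f` by the torus action (`s > 0`) to the component of `f` of weighted degree `d` (`s = 0`). The
exponent `θ > 0` is chosen large enough for the family to be differentiable at `s = 0`. -/
noncomputable def degeneration {n : ℕ} (w : Fin n → ℝ) (d θ : ℝ) (f : MvPolynomial (Fin n) ℝ)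
    (z : ℝ × (Fin n → ℝ)) : ℝ :=
  ∑ a ∈ f.support, coeff a f * z.1 ^ (θ * (d - Finsupp.weight w a)) * ∏ i, z.2 i ^ a i

theorem degeneration_zero {n : ℕ} (w : Fin n → ℝ) (d : ℝ) {θ : ℝ} (hθ : 0 < θ)
    (f : MvPolynomial (Fin n) ℝ) (x : Fin n → ℝ) :
    degeneration w d θ f (0, x) = eval x (weightedHomogeneousComponent w d f) := by
  classical
  rw [weightedHomogeneousComponent_apply, map_sum, Finset.sum_filter]
  refine Finset.sum_congr rfl fun a _ => ?_
  split_ifs with h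
  · simp [h, eval_monomial, Finsupp.prod_fintype]
  · have h1 : θ * (d - Finsupp.weight w a) ≠ 0 := mul_ne_zero hθ.ne' (sub_ne_zero.mpr (Ne.symm h))
    simp [Real.zero_rpow h1]

theorem prod_torusScale_pow {n : ℕ} (w : Fin n → ℝ) {c : ℝ} (hc : 0 < c) (x : Fin n → ℝ)
    (a : Fin n →₀ ℕ) :
    ∏ i, torusScale c w x i ^ a i = c ^ Finsupp.weight w a * ∏ i, x i ^ a i := by
  have h : Finsupp.weight w a = ∑ i, a i • w i := by
    rw [Finsupp.weight_apply, Finsupp.sum_fintype _ _ fun i => by simp]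
  rw [h, Real.rpow_sum_of_pos hc, ← Finset.prod_mul_distrib]
  refine Finset.prod_congr rfl fun i _ => ?_
  rw [torusScale, mul_pow, nsmul_eq_mul, mul_comm (a i : ℝ), Real.rpow_mul hc.le, Real.rpow_natCast]

theorem degeneration_of_pos {n : ℕ} (w : Fin n → ℝ) (d : ℝ) {θ : ℝ} (hθ : 0 < θ)
    (f : MvPolynomial (Fin n) ℝ) {c : ℝ} (hc : 0 < c) (x : Fin n → ℝ) :
    degeneration w d θ f (c ^ (-θ⁻¹), x) = c ^ (-d) * eval (torusScale c w x) f := by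
  rw [eval_eq', Finset.mul_sum]
  refine Finset.sum_congr rfl fun a _ => ?_
  have h : -θ⁻¹ * (θ * (d - Finsupp.weight w a)) = -d + Finsupp.weight w a := by
    field_simp
    ring
  rw [prod_torusScale_pow w hc, ← Real.rpow_mul hc.le, h, Real.rpow_add hc]
  ring

/-- The real powers `s ^ r` with `r ≥ 1` are continuously differentiable on all of `ℝ`, including
the values assigned by convention for `s < 0`, so that the degeneration need not be restricted to
`s ≥ 0`. -/
theorem contDiff_degeneration {n : ℕ} {w : Fin n → ℝ} {d θ : ℝ} {f : MvPolynomial (Fin n) ℝ}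
    (hθ : ∀ a ∈ f.support, Finsupp.weight w a = d ∨ 1 ≤ θ * (d - Finsupp.weight w a)) :
    ContDiff ℝ 1 (degeneration w d θ f) := by
  refine ContDiff.sum fun a ha => ?_
  have h1 : ContDiff ℝ 1 fun s : ℝ => s ^ (θ * (d - Finsupp.weight w a)) := by
    rcases hθ a ha with h | h
    · simp only [h, sub_self, mul_zero, Real.rpow_zero]
      exact contDiff_const
    · exact_mod_cast Real.contDiff_rpow_const_of_le (n := 1) (by exact_mod_cast h)
  refine (contDiff_const.mul (h1.comp contDiff_fst)).mul ?_
  refine contDiff_prod fun i _ => ?_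
  exact (((contDiff_apply ℝ ℝ i).comp contDiff_snd).pow _)

theorem exists_degeneration_exponent {n : ℕ} {κ : Type*} [Finite κ] {w : Fin n → ℝ} {D : κ → ℝ}
    {f : κ → MvPolynomial (Fin n) ℝ} (hf : ∀ i, wDegree w (f i) ≤ D i) :
    ∃ θ : ℝ, 0 < θ ∧ ∀ i, ∀ a ∈ (f i).support,
      Finsupp.weight w a = D i ∨ 1 ≤ θ * (D i - Finsupp.weight w a) := by
  have h : ∀ᶠ θ in (atTop : Filter ℝ), ∀ i, ∀ a ∈ (f i).support,
      Finsupp.weight w a = D i ∨ 1 ≤ θ * (D i - Finsupp.weight w a) := by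
    refine eventually_all.mpr fun i => (Finset.eventually_all _).mpr fun a ha => ?_
    rcases (wDegree_le_iff.mp (hf i) a ha).eq_or_lt with h | h
    · exact Eventually.of_forall fun _ => Or.inl h
    · filter_upwards [(tendsto_id.atTop_mul_const (sub_pos.mpr h)).eventually_ge_atTop 1]
        with θ hθ using Or.inr hθ
  obtain ⟨θ, h1, h2⟩ := ((eventually_gt_atTop 0).and h).exists
  exact ⟨θ, h1, h2⟩

theorem hasFDerivAt_eval {n : ℕ} (p : Fin n → ℝ) (f : MvPolynomial (Fin n) ℝ) :
    HasFDerivAt (fun x => eval x f) (∑ i, gradientAt p f i •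
      ContinuousLinearMap.proj (R := ℝ) (φ := fun _ : Fin n => ℝ) i) p := by
  induction f using MvPolynomial.induction_on with
  | C a =>
    simpa [gradientAt_C] using hasFDerivAt_const a p
  | add f g hf hg =>
    simp only [map_add, Pi.add_apply, add_smul, Finset.sum_add_distrib]
    exact hf.add hg
  | mul_X f j hf =>
    have hj : HasFDerivAt (fun x : Fin n → ℝ => x j)
        (ContinuousLinearMap.proj (R := ℝ) (φ := fun _ : Fin n => ℝ) j) p :=
      (ContinuousLinearMap.proj (R := ℝ) (φ := fun _ : Fin n => ℝ) j).hasFDerivAt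
    have h := hf.mul hj
    simp only [map_mul, eval_X]
    refine h.congr_fderiv ?_
    ext v
    simp [gradientAt_mul, gradientAt_X, add_mul, Finset.sum_add_distrib, mul_assoc, Finset.mul_sum,
      Pi.single_apply]

theorem exists_forall_sum_mul_eq {n : ℕ} {κ : Type*} [Finite κ] {v : κ → Fin n → ℝ}
    (hv : LinearIndependent ℝ v) (y : κ → ℝ) : ∃ u : Fin n → ℝ, ∀ i, ∑ j, v i j * u j = y i := by
  have := Fintype.ofFinite κ
  have h1 : (Matrix.of v).rank = Fintype.card κ := LinearIndependent.rank_matrix hv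
  have h2 : LinearMap.range (Matrix.of v).mulVecLin = ⊤ := by
    refine Submodule.eq_top_of_finrank_eq ?_
    rw [Module.finrank_fintype_fun_eq_card]
    exact h1
  obtain ⟨u, hu⟩ := LinearMap.range_eq_top.mp h2 y
  exact ⟨u, fun i => congrFun hu i⟩

/-- Hensel-type lifting: a common zero `p` of the leading components of `f_1, …, f_k` at which their
gradients are independent is the limit of rescaled common zeros of `f_1, …, f_k`. This is the
implicit function theorem for the degeneration, the parameter `s = c^{-1/θ}` being prescribed as an
additional equation. -/
theorem exists_tendsto_zeros {n : ℕ} {κ : Type*} [Finite κ] {w : Fin n → ℝ} {D : κ → ℝ}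
    {f : κ → MvPolynomial (Fin n) ℝ} (hf : ∀ i, wDegree w (f i) ≤ D i) {p : Fin n → ℝ}
    (hp : ∀ i, eval p (weightedHomogeneousComponent w (D i) (f i)) = 0)
    (hli : LinearIndependent ℝ
      fun i => gradientAt p (weightedHomogeneousComponent w (D i) (f i))) :
    ∃ x : ℝ → Fin n → ℝ, Tendsto x atTop (𝓝 p) ∧
      ∀ᶠ c in atTop, ∀ i, eval (torusScale c w (x c)) (f i) = 0 := by
  have := Fintype.ofFinite κ
  obtain ⟨θ, hθ, hexp⟩ := exists_degeneration_exponent hf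
  set Φ : ℝ × (Fin n → ℝ) → ℝ × (κ → ℝ) :=
    fun z => (z.1, fun i => degeneration w (D i) θ (f i) z) with hΦ
  have hsmooth : ContDiff ℝ 1 Φ :=
    contDiff_fst.prodMk (contDiff_pi.mpr fun i => contDiff_degeneration (hexp i))
  have hstrict : HasStrictFDerivAt Φ (fderiv ℝ Φ (0, p)) (0, p) :=
    hsmooth.contDiffAt.hasStrictFDerivAt one_ne_zero
  have hΦp : Φ (0, p) = (0, 0) := by
    simp only [hΦ]
    congr 1
    ext i
    rw [degeneration_zero w _ hθ, hp i, Pi.zero_apply]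
  have hfst : ∀ z, (fderiv ℝ Φ (0, p) z).1 = z.1 := by
    intro z
    have h1 : HasFDerivAt (fun z => (Φ z).1) ((ContinuousLinearMap.fst ℝ ℝ (κ → ℝ)).comp
        (fderiv ℝ Φ (0, p))) (0, p) := hstrict.hasFDerivAt.fst
    have h2 : HasFDerivAt (fun z : ℝ × (Fin n → ℝ) => z.1)
        (ContinuousLinearMap.fst ℝ ℝ (Fin n → ℝ)) (0, p) := hasFDerivAt_fst
    exact congrArg (fun L => L z) (h1.unique h2)
  have hsnd : ∀ v i, (fderiv ℝ Φ (0, p) (0, v)).2 i =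
      ∑ j, gradientAt p (weightedHomogeneousComponent w (D i) (f i)) j * v j := by
    intro v i
    have h1 := (hasFDerivAt_pi'.mp (hstrict.hasFDerivAt.snd) i).comp p
      (hasFDerivAt_prodMk_right (𝕜 := ℝ) (0 : ℝ) p)
    have h2 := hasFDerivAt_eval p (weightedHomogeneousComponent w (D i) (f i))
    have h3 : ((fun z => (Φ z).2 i) ∘ fun x : Fin n → ℝ => ((0 : ℝ), x)) =
        fun x => eval x (weightedHomogeneousComponent w (D i) (f i)) := by
      ext x
      exact degeneration_zero w _ hθ _ _
    rw [h3] at h1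
    simpa using congrArg (fun L => L v) (h1.unique h2)
  have hsurj : (fderiv ℝ Φ (0, p) : ℝ × (Fin n → ℝ) →ₗ[ℝ] ℝ × (κ → ℝ)).range = ⊤ := by
    refine LinearMap.range_eq_top.mpr fun y => ?_
    obtain ⟨v, hv⟩ := exists_forall_sum_mul_eq hli (y.2 - (fderiv ℝ Φ (0, p) (y.1, 0)).2)
    refine ⟨(y.1, 0) + (0, v), ?_⟩
    rw [ContinuousLinearMap.coe_coe, map_add]
    refine Prod.ext ?_ ?_
    · rw [Prod.fst_add, hfst, hfst, add_zero]
    · ext i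
      rw [Prod.snd_add, Pi.add_apply, hsnd, hv]
      simp
  have hs : Tendsto (fun c : ℝ => c ^ (-θ⁻¹)) atTop (𝓝 0) :=
    tendsto_rpow_neg_atTop (inv_pos.mpr hθ)
  have hs2 : Tendsto (fun c : ℝ => (c ^ (-θ⁻¹), (0 : κ → ℝ))) atTop (𝓝 (Φ (0, p))) := by
    rw [hΦp]
    exact hs.prodMk_nhds tendsto_const_nhds
  set ψ : ℝ → ℝ × (Fin n → ℝ) :=
    fun c => hstrict.implicitFunction Φ _ hsurj (c ^ (-θ⁻¹), 0) 0
  have hψ : Tendsto ψ atTop (𝓝 (0, p)) :=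
    hstrict.tendsto_implicitFunction hsurj hs2 tendsto_const_nhds
  have hψ2 : ∀ᶠ c in atTop, Φ (ψ c) = (c ^ (-θ⁻¹), 0) :=
    (hs2.prodMk_nhds (tendsto_const_nhds (x := (0 : _)))).eventually
      (hstrict.map_implicitFunction_eq hsurj)
  refine ⟨fun c => (ψ c).2, (continuous_snd.tendsto _).comp hψ, ?_⟩
  filter_upwards [hψ2, eventually_gt_atTop 0] with c hc hc0 i
  have h1 : (ψ c).1 = c ^ (-θ⁻¹) := congrArg Prod.fst hc
  have h2 : degeneration w (D i) θ (f i) (ψ c) = 0 := congrFun (congrArg Prod.snd hc) i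
  have h3 : ψ c = (c ^ (-θ⁻¹), (ψ c).2) := Prod.ext h1 rfl
  rw [h3, degeneration_of_pos w _ hθ _ hc0] at h2
  exact (mul_eq_zero.mp h2).resolve_left (Real.rpow_pos_of_pos hc0 _).ne'

/-! ### Weighted degrees and initial forms -/

theorem initialForm_eq {n : ℕ} {w : Fin n → ℝ} {f : MvPolynomial (Fin n) ℝ} {d : ℝ}
    (h : wDegree w f = d) : initialForm w f = weightedHomogeneousComponent w d f := by
  classical
  rw [weightedHomogeneousComponent_apply, initialForm, h]
  have h2 : ∀ a : Fin n →₀ ℕ, ∑ i, w i * (a i : ℝ) = Finsupp.weight w a := by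
    intro a
    rw [Finsupp.weight_apply, Finsupp.sum_fintype _ _ fun i => by simp]
    simp [mul_comm]
  refine Finset.sum_congr (Finset.filter_congr fun a _ => ?_) fun _ _ => rfl
  rw [h2, WithBot.coe_inj]

theorem exists_wDegree_eq {n : ℕ} (w : Fin n → ℝ) {f : MvPolynomial (Fin n) ℝ} (hf : f ≠ 0) :
    ∃ d : ℝ, wDegree w f = d :=
  let ⟨a, ha⟩ := exists_isLeading w hf
  ⟨Finsupp.weight w a, ha.wDegree_eq⟩

theorem exists_wDegree_le {n : ℕ} (w : Fin n → ℝ) (f : MvPolynomial (Fin n) ℝ) :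
    ∃ d : ℝ, wDegree w f ≤ d := by
  by_cases hf : f = 0
  · exact ⟨0, wDegree_le_iff.mpr (by simp [hf])⟩
  · exact (exists_wDegree_eq w hf).imp fun _ h => h.le

theorem exists_lt_wDegree_le {n : ℕ} {w : Fin n → ℝ} {f : MvPolynomial (Fin n) ℝ} {d : ℝ}
    (hf : wDegree w f ≤ d) (h0 : weightedHomogeneousComponent w d f = 0) :
    ∃ d' < d, wDegree w f ≤ (d' : ℝ) := by
  classical
  by_cases hf0 : f = 0
  · exact ⟨d - 1, by linarith, wDegree_le_iff.mpr (by simp [hf0])⟩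
  obtain ⟨a, ha⟩ := exists_isLeading w hf0
  refine ⟨Finsupp.weight w a, lt_of_le_of_ne (wDegree_le_iff.mp hf a ha.1) fun h => ?_,
    ha.wDegree_eq.le⟩
  have h1 := congrArg (coeff a) h0
  rw [coeff_weightedHomogeneousComponent, if_pos h, coeff_zero] at h1
  exact mem_support_iff.mp ha.1 h1

theorem weightedHomogeneousComponent_monomial_mul {n : ℕ} (w : Fin n → ℝ) (b : Fin n →₀ ℕ)
    (r d : ℝ) (f : MvPolynomial (Fin n) ℝ) :
    weightedHomogeneousComponent w (Finsupp.weight w b + d) (monomial b r * f) =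
      monomial b r * weightedHomogeneousComponent w d f := by
  classical
  ext a
  rw [coeff_weightedHomogeneousComponent, coeff_monomial_mul', coeff_monomial_mul',
    coeff_weightedHomogeneousComponent]
  by_cases hb : b ≤ a
  · have h : Finsupp.weight w a = Finsupp.weight w b + Finsupp.weight w (a - b) := by
      rw [← map_add, add_tsub_cancel_of_le hb]
    simp [hb, h]
  · simp [hb]

theorem wDegree_monomial_mul_le {n : ℕ} {w : Fin n → ℝ} (b : Fin n →₀ ℕ) (r : ℝ) {d : ℝ}
    {f : MvPolynomial (Fin n) ℝ} (hf : wDegree w f ≤ d) :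
    wDegree w (monomial b r * f) ≤ (Finsupp.weight w b + d : ℝ) := by
  refine wDegree_le_iff.mpr fun a ha => ?_
  obtain ⟨a, hf', rfl⟩ := exists_add_of_mem_support_monomial_mul ha
  rw [map_add]
  exact add_le_add_right (wDegree_le_iff.mp hf a hf') _

/-! ### Rescaled evaluation and small combinations -/

/-- The rescaled values `c^{-d} f(c^w · x_c)` of `f` along a curve `x`, as functions of `c`. -/
noncomputable def rescaledEval {n : ℕ} (w : Fin n → ℝ) (x : ℝ → Fin n → ℝ) (d : ℝ) :
    MvPolynomial (Fin n) ℝ →ₗ[ℝ] (ℝ → ℝ) where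
  toFun f c := c ^ (-d) * eval (torusScale c w (x c)) f
  map_add' f g := by ext c; simp [mul_add]
  map_smul' r f := by ext c; simp [smul_eval]; ring

theorem rescaledEval_apply {n : ℕ} (w : Fin n → ℝ) (x : ℝ → Fin n → ℝ) (d : ℝ)
    (f : MvPolynomial (Fin n) ℝ) (c : ℝ) :
    rescaledEval w x d f c = c ^ (-d) * eval (torusScale c w (x c)) f := rfl

theorem rescaledEval_monomial_mul {n : ℕ} (w : Fin n → ℝ) (x : ℝ → Fin n → ℝ) (d e : ℝ)
    (b : Fin n →₀ ℕ) (r : ℝ) (f : MvPolynomial (Fin n) ℝ) {c : ℝ} (hc : 0 < c) :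
    rescaledEval w x d (monomial b r * f) c =
      c ^ (-(d - (Finsupp.weight w b + e))) * eval (x c) (monomial b r) *
        rescaledEval w x e f c := by
  have h : ∀ y : Fin n → ℝ, eval y (monomial b r) = r * ∏ i, y i ^ b i := by
    intro y
    rw [eval_monomial, Finsupp.prod_fintype _ _ fun i => by simp]
  have h2 : c ^ (-(d - (Finsupp.weight w b + e))) = c ^ (-d) * c ^ Finsupp.weight w b * c ^ e := by
    rw [← Real.rpow_add hc, ← Real.rpow_add hc]
    congr 1
    ring
  have h3 : c ^ e * c ^ (-e) = 1 := by
    rw [← Real.rpow_add hc, add_neg_cancel, Real.rpow_zero]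
  rw [rescaledEval_apply, rescaledEval_apply, map_mul, h, h, prod_torusScale_pow w hc, h2]
  linear_combination (-(c ^ (-d) * c ^ Finsupp.weight w b * r * (∏ i, x c i ^ b i) *
    eval (torusScale c w (x c)) f)) * h3

/-- The functions of the form `∑ η_l v_l` for large arguments, with coefficients `η_l → 0`. They
play the role of the product of the module spanned by the `v_l` with the maximal ideal. -/
def smallCombinations {ι : Type*} [Fintype ι] (v : ι → ℝ → ℝ) : Submodule ℝ (ℝ → ℝ) where
  carrier := {φ | ∃ η : ι → ℝ → ℝ, (∀ l, Tendsto (η l) atTop (𝓝 0)) ∧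
    ∀ᶠ c in atTop, φ c = ∑ l, η l c * v l c}
  zero_mem' := ⟨0, fun _ => tendsto_const_nhds, by simp⟩
  add_mem' := by
    rintro φ ψ ⟨η, hη, hφ⟩ ⟨ζ, hζ, hψ⟩
    refine ⟨η + ζ, fun l => by simpa only [add_zero] using! (hη l).add (hζ l), ?_⟩
    filter_upwards [hφ, hψ] with c h1 h2
    simp [h1, h2, add_mul, Finset.sum_add_distrib]
  smul_mem' := by
    rintro r φ ⟨η, hη, hφ⟩
    refine ⟨r • η, fun l => by simpa only [mul_zero] using! (hη l).const_mul r, ?_⟩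
    filter_upwards [hφ] with c h1
    simp [h1, Finset.mul_sum, mul_assoc]

theorem mem_smallCombinations_congr {ι : Type*} [Fintype ι] {v : ι → ℝ → ℝ} {φ ψ : ℝ → ℝ}
    (hφ : φ ∈ smallCombinations v) (h : φ =ᶠ[atTop] ψ) : ψ ∈ smallCombinations v := by
  obtain ⟨η, hη, hφ⟩ := hφ
  refine ⟨η, hη, ?_⟩
  filter_upwards [hφ, h] with c h1 h2
  rw [← h2, h1]

/-- The determinant trick: functions that, up to factors with nonzero limits, are small combinations
of each other vanish eventually. -/
theorem eventually_eq_zero_of_mem_smallCombinations {ι : Type*} [Fintype ι] {v u : ι → ℝ → ℝ}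
    {b : ι → ℝ} (hb : ∀ l, b l ≠ 0) (hu : ∀ l, Tendsto (u l) atTop (𝓝 (b l)))
    (h : ∀ l, (fun c => u l c * v l c) ∈ smallCombinations v) :
    ∀ᶠ c in atTop, ∀ l, v l c = 0 := by
  classical
  choose η hη hsum using h
  set M : ℝ → Matrix ι ι ℝ := fun c =>
    Matrix.diagonal (fun l => u l c) - Matrix.of fun l m => η l m c
  have hM : Tendsto M atTop (𝓝 (Matrix.diagonal b)) := by
    refine tendsto_pi_nhds.mpr fun l => tendsto_pi_nhds.mpr fun m => ?_
    have h1 : Tendsto (fun c => Matrix.diagonal (fun l => u l c) l m) atTop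
        (𝓝 (Matrix.diagonal b l m)) := by
      by_cases hlm : l = m
      · subst hlm
        simpa using hu l
      · simp [hlm]
    simpa [M] using h1.sub (hη l m)
  have hdet : Tendsto (fun c => (M c).det) atTop (𝓝 (Matrix.diagonal b).det) :=
    ((continuous_id.matrix_det).tendsto _).comp hM
  have hne : (Matrix.diagonal b).det ≠ 0 := by
    rw [Matrix.det_diagonal]
    exact Finset.prod_ne_zero_iff.mpr fun l _ => hb l
  filter_upwards [hdet.eventually_ne hne, eventually_all.mpr hsum] with c h1 h2
  have h3 : (M c).mulVec (fun l => v l c) = 0 := by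
    ext l
    rw [Matrix.sub_mulVec, Pi.sub_apply, Matrix.mulVec_diagonal, Pi.zero_apply, sub_eq_zero]
    exact h2 l
  exact congrFun (Matrix.eq_zero_of_mulVec_eq_zero h1 h3)

/-! ### Vanishing of the whole ideal -/

section StandardBasis

variable {n : ℕ} {w : Fin n → ℝ} {I : Ideal (MvPolynomial (Fin n) ℝ)} {ι : Type} [Fintype ι]
  {f : ι → MvPolynomial (Fin n) ℝ} {D : ι → ℝ} {p : Fin n → ℝ} {x : ℝ → Fin n → ℝ}

/-- A `g ∈ I` without component of weighted degree `d` has degree less than `d`; as `g` is a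
combination of terms `x^b f_l` of lower degree, rescaling by `c^{-d}` leaves coefficients that tend
to zero. -/
theorem rescaledEval_mem_smallCombinations
    (hbasis : IsStandardBasis w I f D) (hx : Tendsto x atTop (𝓝 p))
    {g : MvPolynomial (Fin n) ℝ} (hg : g ∈ I) {d : ℝ} (hd : wDegree w g ≤ d)
    (h0 : weightedHomogeneousComponent w d g = 0) :
    rescaledEval w x d g ∈ smallCombinations fun l => rescaledEval w x (D l) (f l) := by
  classical
  obtain ⟨d', hlt, hd'⟩ := exists_lt_wDegree_le hd h0
  have hle := Submodule.span_le (p := (smallCombinations fun l =>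
    rescaledEval w x (D l) (f l)).comap (rescaledEval w x d)) (s :=
    {q | ∃ l b, Finsupp.weight w b + D l ≤ d' ∧ q = monomial b (1 : ℝ) * f l})
  refine hle.mpr ?_ (hbasis.mem_span g hg d' hd')
  rintro _ ⟨l, b, hb, rfl⟩
  set η : ℝ → ℝ := fun c => c ^ (-(d - (Finsupp.weight w b + D l))) *
    eval (x c) (monomial b (1 : ℝ)) with hηdef
  have hη : Tendsto η atTop (𝓝 0) := by
    have h1 := (tendsto_rpow_neg_atTop (y := d - (Finsupp.weight w b + D l)) (by linarith)).mul
      (((MvPolynomial.continuous_eval (monomial b (1 : ℝ))).tendsto p).comp hx)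
    rw [zero_mul] at h1
    exact h1
  refine ⟨fun m => if m = l then η else 0, fun m => ?_, ?_⟩
  · by_cases hm : m = l
    · simpa [hm] using hη
    · simp only [if_neg hm]
      exact tendsto_const_nhds
  · filter_upwards [eventually_gt_atTop 0] with c hc
    rw [rescaledEval_monomial_mul w x d (D l) b 1 (f l) hc, Finset.sum_eq_single l]
    · simp [hηdef]
    · intro m _ hm
      simp [hm]
    · simp

/-- If leading components of elements of `I`, possibly of different degrees, cancel, then they
cancel in each degree, and the sum of the rescaled elements is small. -/
theorem sum_rescaledEval_mem_smallCombinations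
    (hbasis : IsStandardBasis w I f D) (hx : Tendsto x atTop (𝓝 p)) {τ : Type*} (s : Finset τ)
    {P : τ → MvPolynomial (Fin n) ℝ} {e : τ → ℝ} (hP : ∀ i ∈ s, P i ∈ I)
    (he : ∀ i ∈ s, wDegree w (P i) ≤ e i)
    (h0 : ∑ i ∈ s, weightedHomogeneousComponent w (e i) (P i) = 0) :
    ∑ i ∈ s, rescaledEval w x (e i) (P i) ∈
      smallCombinations fun l => rescaledEval w x (D l) (f l) := by
  classical
  rw [← Finset.sum_fiberwise_of_maps_to (t := s.image e) fun i hi => Finset.mem_image_of_mem e hi]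
  refine Submodule.sum_mem _ fun d _ => ?_
  have h1 : ∑ i ∈ s with e i = d, rescaledEval w x (e i) (P i) =
      rescaledEval w x d (∑ i ∈ s with e i = d, P i) := by
    rw [map_sum]
    exact Finset.sum_congr rfl fun i hi => by rw [(Finset.mem_filter.mp hi).2]
  rw [h1]
  refine rescaledEval_mem_smallCombinations hbasis hx
    (I.sum_mem fun i hi => hP i (Finset.mem_filter.mp hi).1) (wDegree_le_iff.mpr fun a ha => ?_) ?_
  · obtain ⟨i, hi, hai⟩ := Finset.mem_biUnion.mp (support_sum ha)
    obtain ⟨his, hid⟩ := Finset.mem_filter.mp hi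
    exact hid ▸ wDegree_le_iff.mp (he i his) a hai
  · have h2 := congrArg (weightedHomogeneousComponent w d) h0
    rw [map_sum, map_zero] at h2
    rw [map_sum, Finset.sum_filter]
    refine Eq.trans ?_ h2
    refine Finset.sum_congr rfl fun i _ => ?_
    rw [weightedHomogeneousComponent_of_mem (weightedHomogeneousComponent_mem w (P i) (e i))]
    by_cases h : e i = d
    · simp [h]
    · rw [if_neg h, if_neg (Ne.symm h)]

/-- Flatness of the degeneration: a relation between the leading components of elements of `I` holds
between the rescaled elements themselves, up to a small error. -/
theorem relation_mem_smallCombinations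
    (hbasis : IsStandardBasis w I f D) (hx : Tendsto x atTop (𝓝 p)) {κ : Type*} [Fintype κ]
    {g A : κ → MvPolynomial (Fin n) ℝ}
    {e : κ → ℝ} (hg : ∀ i, g i ∈ I) (he : ∀ i, wDegree w (g i) ≤ e i)
    (h0 : ∑ i, A i * weightedHomogeneousComponent w (e i) (g i) = 0) :
    (fun c => ∑ i, eval (x c) (A i) * rescaledEval w x (e i) (g i) c) ∈
      smallCombinations fun l => rescaledEval w x (D l) (f l) := by
  set P : (Σ _ : κ, Fin n →₀ ℕ) → MvPolynomial (Fin n) ℝ :=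
    fun y => monomial y.2 (coeff y.2 (A y.1)) * g y.1
  have h := sum_rescaledEval_mem_smallCombinations hbasis hx
    (Finset.univ.sigma fun i => (A i).support) (P := P)
    (e := fun y => Finsupp.weight w y.2 + e y.1) (fun y _ => I.mul_mem_left _ (hg y.1))
    (fun y _ => wDegree_monomial_mul_le _ _ (he y.1)) (by
      rw [Finset.sum_sigma, ← h0]
      refine Finset.sum_congr rfl fun i _ => ?_
      simp only [P, weightedHomogeneousComponent_monomial_mul]
      rw [← Finset.sum_mul, support_sum_monomial_coeff])
  refine mem_smallCombinations_congr h ?_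
  filter_upwards [eventually_gt_atTop 0] with c hc
  rw [Finset.sum_apply, Finset.sum_sigma]
  refine Finset.sum_congr rfl fun i _ => ?_
  have h1 : ∀ b, rescaledEval w x (Finsupp.weight w b + e i) (P ⟨i, b⟩) c =
      eval (x c) (monomial b (coeff b (A i))) * rescaledEval w x (e i) (g i) c := by
    intro b
    simp only [P]
    rw [rescaledEval_monomial_mul w x _ (e i) _ _ _ hc, sub_self, neg_zero, Real.rpow_zero, one_mul]
  simp only [h1]
  rw [← Finset.sum_mul, ← map_sum, support_sum_monomial_coeff]

/-- If the leading components of `g_1, …, g_k ∈ I` generate those of the `f_l` locally at `p`, then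
the rescaled common zeros of the `g_i` near `p` are zeros of all of `I`. -/
theorem eventually_mem_realVariety (hbasis : IsStandardBasis w I f D)
    (hx : Tendsto x atTop (𝓝 p)) {κ : Type*} [Fintype κ] {g : κ → MvPolynomial (Fin n) ℝ}
    {e : κ → ℝ} (hg : ∀ i, g i ∈ I) (he : ∀ i, wDegree w (g i) ≤ e i)
    (hzero : ∀ᶠ c in atTop, ∀ i, eval (torusScale c w (x c)) (g i) = 0)
    (hloc : ∀ l, ∃ u, eval p u ≠ 0 ∧ u * weightedHomogeneousComponent w (D l) (f l) ∈
      Ideal.span (Set.range fun i => weightedHomogeneousComponent w (e i) (g i))) :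
    ∀ᶠ c in atTop, torusScale c w (x c) ∈ realVariety I := by
  choose u hu hmem using hloc
  have hsmall : ∀ l, (fun c => eval (x c) (u l) * rescaledEval w x (D l) (f l) c) ∈
      smallCombinations fun l => rescaledEval w x (D l) (f l) := by
    intro l
    obtain ⟨A, hA⟩ := Ideal.mem_span_range_iff_exists_fun.mp (hmem l)
    have h := relation_mem_smallCombinations hbasis hx
      (g := fun i : Option κ => i.elim (f l) g) (e := fun i => i.elim (D l) e)
      (A := fun i => i.elim (u l) fun i => -A i)
      (by rintro (_ | i); exacts [hbasis.mem l, hg i])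
      (by rintro (_ | i); exacts [(hbasis.wDegree_eq l).le, he i])
      (by simp [Fintype.sum_option, ← hA])
    refine mem_smallCombinations_congr h ?_
    filter_upwards [hzero] with c hc
    simp [Fintype.sum_option, rescaledEval_apply, hc]
  have hv := eventually_eq_zero_of_mem_smallCombinations hu
    (fun l => ((MvPolynomial.continuous_eval (u l)).tendsto p).comp hx) hsmall
  filter_upwards [hv, eventually_gt_atTop 0] with c hc hc0 h hh
  have hf0 : ∀ l, eval (torusScale c w (x c)) (f l) = 0 := fun l =>
    (mul_eq_zero.mp (hc l)).resolve_left (Real.rpow_pos_of_pos hc0 _).ne'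
  obtain ⟨d, hd⟩ := exists_wDegree_le w h
  have hle := Submodule.span_le (p := (pointIdeal (torusScale c w (x c))).restrictScalars ℝ) (s :=
    {q | ∃ l b, Finsupp.weight w b + D l ≤ d ∧ q = monomial b (1 : ℝ) * f l})
  refine mem_pointIdeal.mp (hle.mpr ?_ (hbasis.mem_span h hh d hd))
  rintro _ ⟨l, b, -, rfl⟩
  exact mem_pointIdeal.mpr (by rw [map_mul, hf0, mul_zero])

end StandardBasis

/-- A nonsingular point of the variety of the initial ideal is a limit of rescaled points of the
variety of `I`. -/
theorem exists_tendsto_mem_realVariety {n : ℕ} (I : Ideal (MvPolynomial (Fin n) ℝ))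
    (w p : Fin n → ℝ) (hp : IsNonsingularPoint (initialIdeal w I) p) :
    ∃ x : ℝ → Fin n → ℝ, Tendsto x atTop (𝓝 p) ∧
      ∀ᶠ c in atTop, torusScale c w (x c) ∈ realVariety I := by
  obtain ⟨hp0, hreg⟩ := hp
  obtain ⟨κ, _, q, hq, hli, hloc⟩ := exists_local_generators p
    {g | ∃ f ∈ I, g = initialForm w f} (fun g hg => hp0 g (Ideal.subset_span hg)) hreg
  choose g hgI hgq using hq
  have hdeg : ∀ i, ∃ d : ℝ, wDegree w (g i) = d := by
    -- Independent gradients are nonzero, so `g i ≠ 0`.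
    refine fun i => exists_wDegree_eq w fun h => hli.ne_zero i ?_
    rw [hgq i, h]
    simp [initialForm]
  choose e he using hdeg
  have hqe : q = fun i => weightedHomogeneousComponent w (e i) (g i) :=
    funext fun i => (hgq i).trans (initialForm_eq (he i))
  subst hqe
  obtain ⟨x, hx, hzero⟩ := exists_tendsto_zeros (fun i => (he i).le)
    (fun i => hp0 _ (Ideal.subset_span ⟨g i, hgI i, hgq i⟩)) hli
  obtain ⟨ι, _, f, D, hbasis⟩ := exists_finite_standard_basis w I
  exact ⟨x, hx, eventually_mem_realVariety hbasis hx hgI (fun i => (he i).le) hzero fun l =>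
    hloc _ (Ideal.subset_span ⟨f l, hbasis.mem l, (initialForm_eq (hbasis.wDegree_eq l)).symm⟩)⟩

/-! ### The logarithmic limit set -/

/-- Along a curve `x_c → p` with `p` in the torus, `log_c |c^w · x_c| → w`. -/
theorem tendsto_logb_abs_torusScale {n : ℕ} (w : Fin n → ℝ) {p : Fin n → ℝ} (hp : ∀ i, p i ≠ 0)
    {x : ℝ → Fin n → ℝ} (hx : Tendsto x atTop (𝓝 p)) :
    Tendsto (fun c i => Real.logb c |torusScale c w (x c) i|) atTop (𝓝 w) := by
  refine tendsto_pi_nhds.mpr fun i => ?_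
  have hxi : Tendsto (fun c => x c i) atTop (𝓝 (p i)) := tendsto_pi_nhds.mp hx i
  have h1 : Tendsto (fun c => w i + Real.log |x c i| / Real.log c) atTop (𝓝 (w i + 0)) :=
    ((hxi.abs.log (abs_ne_zero.mpr (hp i))).div_atTop Real.tendsto_log_atTop).const_add _
  rw [add_zero] at h1
  refine h1.congr' ?_
  filter_upwards [eventually_gt_atTop 1, hxi.eventually_ne (hp i)] with c hc hxc
  have hc0 : 0 < c := one_pos.trans hc
  have hlog : Real.log c ≠ 0 := (Real.log_pos hc).ne'
  rw [torusScale, abs_mul, abs_of_pos (Real.rpow_pos_of_pos hc0 _), Real.logb,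
    Real.log_mul (Real.rpow_pos_of_pos hc0 _).ne' (abs_ne_zero.mpr hxc), Real.log_rpow hc0]
  field_simp

theorem mem_logLimitSet_of_tendsto {n : ℕ} {I : Ideal (MvPolynomial (Fin n) ℝ)} {w p : Fin n → ℝ}
    (hp : ∀ i, p i ≠ 0) {x : ℝ → Fin n → ℝ} (hx : Tendsto x atTop (𝓝 p))
    (hI : ∀ᶠ c in atTop, torusScale c w (x c) ∈ realVariety I) :
    w ∈ logLimitSet (absSet (realTorusVariety I)) := by
  have hgood : ∀ᶠ c in atTop, 1 < c ∧ torusScale c w (x c) ∈ realTorusVariety I := by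
    have hne : ∀ᶠ c in atTop, ∀ i, x c i ≠ 0 :=
      eventually_all.mpr fun i => (tendsto_pi_nhds.mp hx i).eventually_ne (hp i)
    filter_upwards [hI, hne, eventually_gt_atTop 1] with c h1 h2 h3
    exact ⟨h3, fun i => mul_ne_zero (Real.rpow_pos_of_pos (one_pos.trans h3) _).ne' (h2 i), h1⟩
  obtain ⟨c₀, hc₀⟩ := eventually_atTop.mp hgood
  set c : ℕ → ℝ := fun k => c₀ + k
  have hc : Tendsto c atTop atTop :=
    tendsto_atTop_add_const_left _ _ tendsto_natCast_atTop_atTop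
  have hck : ∀ k, 1 < c k ∧ torusScale (c k) w (x (c k)) ∈ realTorusVariety I :=
    fun k => hc₀ _ (by simp [c])
  refine ⟨fun k i => |torusScale (c k) w (x (c k)) i|, fun k => (c k)⁻¹,
    fun k => ⟨_, (hck k).2, rfl⟩,
    fun k => ⟨inv_pos.mpr (one_pos.trans (hck k).1), inv_lt_one_of_one_lt₀ (hck k).1⟩,
    tendsto_inv_atTop_zero.comp hc, ?_⟩
  simpa only [one_div, inv_inv] using! (tendsto_logb_abs_torusScale w hp hx).comp hc

end RealTropical

theorem mainTheorem5 (n : ℕ) (I : Ideal (MvPolynomial (Fin n) ℝ)) (w : Fin n → ℝ) :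
    (∀ p : Fin n → ℝ, RealTropical.IsNonsingularPoint (RealTropical.initialIdeal w I) p →
      ∃ c₀ : ℝ, 0 < c₀ ∧ ∃ x : ℝ → Fin n → ℝ,
        (∀ c : ℝ, c₀ < c → RealTropical.torusScale c w (x c) ∈ RealTropical.realVariety I) ∧
        Tendsto x atTop (𝓝 p)) ∧
    ((∃ p ∈ RealTropical.realTorusVariety (RealTropical.initialIdeal w I),
        RealTropical.IsNonsingularPoint (RealTropical.initialIdeal w I) p) →
      w ∈ RealTropical.logLimitSet (RealTropical.absSet (RealTropical.realTorusVariety I))) := by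
  refine ⟨fun p hp => ?_, ?_⟩
  · obtain ⟨x, hx, hI⟩ := RealTropical.exists_tendsto_mem_realVariety I w p hp
    obtain ⟨c₀, hc₀⟩ := eventually_atTop.mp hI
    exact ⟨max c₀ 1, lt_max_of_lt_right one_pos, x,
      fun c hc => hc₀ c ((le_max_left _ _).trans hc.le), hx⟩
  · rintro ⟨p, hpT, hp⟩
    obtain ⟨x, hx, hI⟩ := RealTropical.exists_tendsto_mem_realVariety I w p hp
    exact RealTropical.mem_logLimitSet_of_tendsto hpT.1 hx hI
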